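/- Let $\alpha>1$, $l\ge 0$, $t_0\in\mathbb R$, and let $x_{p0},x_{e0}\in\mathbb R^2$ satisfy $\|x_{p0}-x_{e0}\|>l$ (Euclidean norm). Let $\mathcal U_{t_0}$ be the set of piecewise continuous functions $u:[t_0,\infty)\to\{v\in\mathbb R^2:\|v\|=1\}$ (finitely many discontinuities in every bounded interval, one-sided limits everywhere). For controls $u_p,u_e\in\mathcal U_{t_0}$ of the pursuer and the evader, who move in the plane without obstacles, put $$x_p(t)=x_{p0}+\int_{t_0}^t\alpha u_p(s)\,ds,\qquad x_e(t)=x_{e0}+\int_{t_0}^t u_e(s)\,ds ,$$ and let $t_f(u_p,u_e)=\inf\{t\ge t_0:\|x_p(t)-x_e(t)\|\le l\}\in[t_0,+\infty]$ be the capture time ($\inf\emptyset=+\infty$). For $x_1,x_2\in\mathbb R^2$ let $$\mathcal D_l(x_1,x_2)=\{x\in\mathbb R^2:\|x-x_1\|-\alpha\|x-x_2\|>l\}.$$ A map $\delta:\mathcal U_{t_0}\to\mathcal U_{t_0}$ is non-anticipative if, for all $t'>t_0$ and all $u,u'\in\mathcal U_{t_0}$, $u=u'$ a.e. on $[t_0,t']$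 implies $\delta[u]=\delta[u']$ a.e. on $[t_0,t']$. Whenever $\|x_p-x_e\|>l$ and $\|u\|=1$, the ray $\{x_e+su:s\ge0\}$ meets the boundary $\partial\mathcal D_l(x_p,x_e)$ (a Cartesian oval) in exactly one point $x_c(x_p,x_e,u)$; put $\gamma(x_p,x_e,u)=\frac{x_c(x_p,x_e,u)-x_p}{\|x_c(x_p,x_e,u)-x_p\|}$. There is a non-anticipative strategy $\delta^*:\mathcal U_{t_0}\to\mathcal U_{t_0}$ such that, for every $u_e\in\mathcal U_{t_0}$, with $u_p=\delta^*[u_e]$, $$\delta^*[u_e](t)=\gamma(x_p(t),x_e(t),u_e(t))\qquad\text{for all } t\in[t_0,t_f(\delta^*[u_e],u_e)),$$ and every such strategy $\delta^*$, whatever it prescribes after capture, satisfies: (a) there is a constant $c>0$ such that $t_f(\delta^*[u_e],u_e)<c$ for all $u_e\in\mathcal U_{t_0}$; namely, for all $u_e\in\mathcal U_{t_0}$, $$t_f(\delta^*[u_e],u_e)\le t_0+\frac{\|x_{p0}-x_{e0}\|-l}{\alpha-1};$$ (b) for all $u_e\in\mathcal U_{t_0}$ and all $t\in[t_0,t_f(\delta^*[u_e],u_e))$,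 $x_e(t)\in\mathcal D_l(x_{p0},x_{e0})$. -/

import Mathlib

open Set Filter Topology MeasureTheory

noncomputable section

namespace PursuitEvasion

/-- The plane with its Euclidean norm. -/
abbrev Plane := EuclideanSpace ℝ (Fin 2)

/-- Piecewise continuity on `[t₀, ∞)`: finitely many discontinuities in every bounded interval,
and one-sided limits everywhere. -/
def PiecewiseContinuous (t₀ : ℝ) (u : ℝ → Plane) : Prop :=
  (∀ T : ℝ, {t | t ∈ Icc t₀ T ∧ ¬ ContinuousWithinAt u (Ici t₀) t}.Finite) ∧
  (∀ t, t₀ ≤ t → ∃ a, Tendsto u (𝓝[>] t) (𝓝 a)) ∧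
  (∀ t, t₀ < t → ∃ a, Tendsto u (𝓝[<] t) (𝓝 a))

/-- Control input functions on `[t₀, ∞)`: piecewise continuous, with values in the unit circle.
The values before time `t₀` are irrelevant. -/
def Controls (t₀ : ℝ) : Set (ℝ → Plane) :=
  {u | (∀ t, t₀ ≤ t → ‖u t‖ = 1) ∧ PiecewiseContinuous t₀ u}

/-- The solution at time `t` of `ẋ = v • u`, `x t₀ = x₀`, for a player of speed `v`. -/
def traj (v t₀ : ℝ) (x₀ : Plane) (u : ℝ → Plane) (t : ℝ) : Plane :=
  x₀ + ∫ s in t₀..t, v • u s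

/-- The terminal time: the infimum of the times at which the distance between the pursuer
(speed `α`) and the evader (speed `1`) is at most `l`; it is `⊤` if there is no such time. -/
def terminalTime (α l t₀ : ℝ) (xp₀ xe₀ : Plane) (up ue : ℝ → Plane) : EReal :=
  sInf ((fun t : ℝ => (t : EReal)) ''
    {t : ℝ | t₀ ≤ t ∧ ‖traj α t₀ xp₀ up t - traj 1 t₀ xe₀ ue t‖ ≤ l})

/-- The dominance region `𝒟_l(x₁, x₂)` of an evader at `x₂` against a pursuer at `x₁`. -/
def dominanceRegion (α l : ℝ) (x₁ x₂ : Plane) : Set Plane :=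
  {x | ‖x - x₁‖ - α * ‖x - x₂‖ > l}

/-- `x` lies on the ray from `xe` along `u` and on the boundary of `𝒟_l(xp, xe)`. -/
def IsAimPoint (α l : ℝ) (xp xe u x : Plane) : Prop :=
  (∃ s : ℝ, 0 ≤ s ∧ x = xe + s • u) ∧ x ∈ frontier (dominanceRegion α l xp xe)

/-- The intersection point of that ray and that boundary. -/
def aimPoint (α l : ℝ) (xp xe u : Plane) : Plane :=
  Classical.epsilon (IsAimPoint α l xp xe u)

/-- The pursuer's heading: the unit vector from `xp` towards the aim point. -/
def heading (α l : ℝ) (xp xe u : Plane) : Plane :=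
  ‖aimPoint α l xp xe u - xp‖⁻¹ • (aimPoint α l xp xe u - xp)

/-- Non-anticipative strategies of the pursuer. -/
def NonAnticipative (t₀ : ℝ) (δ : Controls t₀ → Controls t₀) : Prop :=
  ∀ t', t₀ < t' → ∀ u u' : Controls t₀,
    (∀ᵐ t ∂(volume.restrict (Icc t₀ t')), u.1 t = u'.1 t) →
    ∀ᵐ t ∂(volume.restrict (Icc t₀ t')), (δ u).1 t = (δ u').1 t

/-- `δ` is a strategy `δ*` generated by `heading`: it is non-anticipative, and up to the end of
the game the pursuer's control is the heading at the current positions and the evader's current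
control. What `δ` prescribes after the end of the game is immaterial. -/
def IsDeltaStar (α l t₀ : ℝ) (xp₀ xe₀ : Plane) (δ : Controls t₀ → Controls t₀) : Prop :=
  NonAnticipative t₀ δ ∧
  ∀ u : Controls t₀, ∀ t : ℝ, t₀ ≤ t →
    (t : EReal) < terminalTime α l t₀ xp₀ xe₀ (δ u).1 u.1 →
    (δ u).1 t = heading α l (traj α t₀ xp₀ (δ u).1 t) (traj 1 t₀ xe₀ u.1 t) (u.1 t)

end PursuitEvasion

end

/-! Write `r = xe - xp`. The aim point in direction `u` is `xe + s • u`, where `‖r + s • u‖ = l + α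
* s`. The excess `‖r + s • u‖ - α * s - l` falls at rate at least `α - 1` in `s`, so the positive
root `s = travel α l r u` is its only zero, and the heading is `pursuit α l r u`.

Existence: for `l > 0`, `travel` and `pursuit` extend into the capture disc and are globally
Lipschitz in `r`. Picard iteration then solves the closed loop, and uniqueness makes the strategy
non-anticipative. For `l = 0` the Lipschitz bound is lost at `r = 0`, but `r` only shrinks along its
initial direction and the heading is invariant under scaling of `r`, so the control is explicit.

(a) The triangle inequality in the triangle of pursuer, evader and aim point bounds the right
derivative of the distance by `-(α - 1)` (`inner_relative_velocity_le`).

(b) Fix the evader's position `y` at time `T` and follow the excess of `y` over the current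
dominance region. At a boundary point `y ≠ xe` its right derivative is `α` times a difference of
inner products, nonpositive by `inner_le_inner_pursuit`; at positive excess it is at most a constant
times the excess (`inner_sub_inner_le`). By Grönwall the excess cannot become positive if it was not
so initially, yet it is positive at time `T`. -/

noncomputable section

namespace PursuitEvasion

/-! ### Geometry of the aim point and of the pursuer's heading -/

section

/-- The distance from the evader to the aim point in the direction `u`, as a function of the
relative position `r` of the evader. Inside the capture disc it is `0`. -/
def travel (α l : ℝ) (r u : Plane) : ℝ :=
  (-(α * l - inner ℝ r u) + √((α * l - inner ℝ r u) ^ 2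
    + (α ^ 2 - 1) * max (‖r‖ ^ 2 - l ^ 2) 0)) / (α ^ 2 - 1)

/-- The direction from the pursuer to the aim point, as a function of the relative position `r`
of the evader. -/
def pursuit (α l : ℝ) (r u : Plane) : Plane :=
  (l + α * travel α l r u)⁻¹ • (r + travel α l r u • u)

variable {α l : ℝ} {r r' u w : Plane}

lemma sq_sub_one_pos (hα : 1 < α) : 0 < α ^ 2 - 1 := by nlinarith

lemma travel_nonneg (hα : 1 < α) : 0 ≤ travel α l r u := by
  have h := sq_sub_one_pos hα
  refine div_nonneg ?_ h.le
  have h1 : |α * l - inner ℝ r u| ≤ √((α * l - inner ℝ r u) ^ 2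
      + (α ^ 2 - 1) * max (‖r‖ ^ 2 - l ^ 2) 0) := by
    apply Real.abs_le_sqrt
    have : 0 ≤ (α ^ 2 - 1) * max (‖r‖ ^ 2 - l ^ 2) 0 := mul_nonneg h.le (le_max_right _ _)
    linarith
  linarith [le_abs_self (α * l - inner ℝ r u)]

lemma inner_le_norm_of_unit (hu : ‖u‖ = 1) : inner ℝ r u ≤ ‖r‖ := by
  simpa [hu] using real_inner_le_norm r u

lemma travel_of_norm_le (hα : 1 < α) (hl : 0 ≤ l) (hu : ‖u‖ = 1) (hr : ‖r‖ ≤ l) :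
    travel α l r u = 0 := by
  have h1 : max (‖r‖ ^ 2 - l ^ 2) 0 = 0 := max_eq_right (by nlinarith [norm_nonneg r])
  have h2 : 0 ≤ α * l - inner ℝ r u := by
    have := inner_le_norm_of_unit (r := r) hu
    nlinarith
  simp [travel, h1, Real.sqrt_sq h2]

lemma travel_quadratic (hα : 1 < α) (hl : 0 ≤ l) (hr : l ≤ ‖r‖) :
    (α ^ 2 - 1) * travel α l r u ^ 2 + 2 * (α * l - inner ℝ r u) * travel α l r u
      = ‖r‖ ^ 2 - l ^ 2 := by
  have h := sq_sub_one_pos hα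
  have h1 : max (‖r‖ ^ 2 - l ^ 2) 0 = ‖r‖ ^ 2 - l ^ 2 := max_eq_left (by nlinarith)
  have h2 : 0 ≤ (α * l - inner ℝ r u) ^ 2 + (α ^ 2 - 1) * (‖r‖ ^ 2 - l ^ 2) := by
    have : 0 ≤ (α ^ 2 - 1) * (‖r‖ ^ 2 - l ^ 2) := mul_nonneg h.le (by nlinarith)
    positivity
  have h3 := Real.sq_sqrt h2
  rw [travel, h1]
  set A := α * l - inner ℝ r u
  set q := √(A ^ 2 + (α ^ 2 - 1) * (‖r‖ ^ 2 - l ^ 2))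
  have h' := h.ne'
  field_simp
  linear_combination h3

lemma norm_add_smul_sq (hu : ‖u‖ = 1) (s : ℝ) :
    ‖r + s • u‖ ^ 2 = ‖r‖ ^ 2 + 2 * s * inner ℝ r u + s ^ 2 := by
  rw [norm_add_sq_real, inner_smul_right, norm_smul, hu, mul_one, Real.norm_eq_abs, sq_abs]
  ring

lemma norm_add_travel (hα : 1 < α) (hl : 0 ≤ l) (hu : ‖u‖ = 1) (hr : l ≤ ‖r‖) :
    ‖r + travel α l r u • u‖ = l + α * travel α l r u := by
  have hs : 0 ≤ travel α l r u := travel_nonneg hα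
  rw [← sq_eq_sq₀ (norm_nonneg _) (by positivity), norm_add_smul_sq hu]
  linear_combination -travel_quadratic (u := u) hα hl hr

/-- Covers both sides of the capture circle at once; as `max · l` is 1-Lipschitz, it gives the
Lipschitz bound on `travel` without cases. -/
lemma max_norm_add_travel (hα : 1 < α) (hl : 0 ≤ l) (hu : ‖u‖ = 1) :
    max ‖r + travel α l r u • u‖ l = l + α * travel α l r u := by
  rcases le_total l ‖r‖ with hr | hr
  · rw [norm_add_travel hα hl hu hr]
    have : 0 ≤ travel α l r u := travel_nonneg hα
    exact max_eq_left (by nlinarith)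
  · simp [travel_of_norm_le hα hl hu hr, hr]

lemma norm_add_travel_le (hα : 1 < α) (hl : 0 ≤ l) (hu : ‖u‖ = 1) :
    ‖r + travel α l r u • u‖ ≤ l + α * travel α l r u :=
  (le_max_left _ _).trans (max_norm_add_travel hα hl hu).le

/-- Moving along a ray by `s - s'` changes the distance to any point by at most `|s - s'|`. -/
lemma norm_add_smul_sub_le (hu : ‖u‖ = 1) (s s' : ℝ) :
    ‖r + s • u‖ - ‖r + s' • u‖ ≤ |s - s'| := by
  have := norm_sub_norm_le (r + s • u) (r + s' • u)
  rwa [add_sub_add_left_eq_sub, ← sub_smul, norm_smul, hu, mul_one, Real.norm_eq_abs] at this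

lemma mul_abs_travel_sub_le (hα : 1 < α) (hl : 0 ≤ l) (hu : ‖u‖ = 1) :
    (α - 1) * |travel α l r u - travel α l r' u| ≤ ‖r - r'‖ := by
  have h1 := max_norm_add_travel (r := r) hα hl hu
  have h2 := max_norm_add_travel (r := r') hα hl hu
  set s := travel α l r u
  set s' := travel α l r' u
  have h3 := abs_max_sub_max_le_abs ‖r + s • u‖ ‖r' + s' • u‖ l
  rw [h1, h2] at h3
  have h4 := abs_norm_sub_norm_le (r + s • u) (r' + s' • u)
  have h5 : (r + s • u) - (r' + s' • u) = (r - r') + (s - s') • u := by module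
  have h6 := norm_add_le (r - r') ((s - s') • u)
  rw [norm_smul, hu, mul_one, Real.norm_eq_abs] at h6
  rw [h5] at h4
  have h7 : |l + α * s - (l + α * s')| = α * |s - s'| := by
    rw [add_sub_add_left_eq_sub, ← mul_sub, abs_mul, abs_of_pos (by linarith)]
  linarith

lemma travel_pos (hα : 1 < α) (hl : 0 ≤ l) (hu : ‖u‖ = 1) (hr : l < ‖r‖) :
    0 < travel α l r u := by
  refine lt_of_le_of_ne (travel_nonneg hα) fun h => ?_
  have h1 := norm_add_travel hα hl hu hr.le
  rw [← h] at h1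
  simp at h1
  linarith

/-- Free of `‖u‖ = 1`, since the heading must be continuous in `u` on the whole plane when it is
composed with a control. -/
lemma travel_zero_pos (hα : 1 < α) (hr : r ≠ 0) : 0 < travel α 0 r u := by
  have h1 := sq_sub_one_pos hα
  refine div_pos ?_ h1
  have h2 : |α * 0 - inner ℝ r u| < √((α * 0 - inner ℝ r u) ^ 2
      + (α ^ 2 - 1) * max (‖r‖ ^ 2 - 0 ^ 2) 0) := by
    rw [← Real.sqrt_sq_eq_abs]
    apply Real.sqrt_lt_sqrt (sq_nonneg _)
    have : 0 < (α ^ 2 - 1) * max (‖r‖ ^ 2 - 0 ^ 2) 0 :=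
      mul_pos h1 (lt_max_of_lt_left (by
        rw [zero_pow two_ne_zero, sub_zero]
        exact pow_pos (norm_pos_iff.2 hr) 2))
    linarith
  linarith [le_abs_self (α * 0 - inner ℝ r u)]

/-- The excess of the pursuer's distance decreases along a ray at rate at least `α - 1`. -/
lemma mul_travel_sub_le (hα : 1 < α) (hl : 0 ≤ l) (hu : ‖u‖ = 1) (hr : l ≤ ‖r‖) {s : ℝ}
    (hs : s ≤ travel α l r u) :
    (α - 1) * (travel α l r u - s) ≤ ‖r + s • u‖ - α * s - l := by
  have h1 := norm_add_travel hα hl hu hr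
  have h2 := norm_add_smul_sub_le (r := r) hu (travel α l r u) s
  rw [abs_of_nonneg (by linarith)] at h2
  linarith

lemma mul_sub_travel_le (hα : 1 < α) (hl : 0 ≤ l) (hu : ‖u‖ = 1) (hr : l ≤ ‖r‖) {s : ℝ}
    (hs : travel α l r u ≤ s) :
    ‖r + s • u‖ - α * s - l ≤ (α - 1) * (travel α l r u - s) := by
  have h1 := norm_add_travel hα hl hu hr
  have h2 := norm_add_smul_sub_le (r := r) hu s (travel α l r u)
  rw [abs_of_nonneg (by linarith)] at h2
  linarith

lemma eq_travel (hα : 1 < α) (hl : 0 ≤ l) (hu : ‖u‖ = 1) (hr : l ≤ ‖r‖) {s : ℝ}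
    (hs : ‖r + s • u‖ = l + α * s) : s = travel α l r u := by
  rcases le_total s (travel α l r u) with h | h
  · have := mul_travel_sub_le hα hl hu hr h
    nlinarith
  · have := mul_sub_travel_le hα hl hu hr h
    nlinarith

/-- For `l = 0` the defining equation `‖r + s • u‖ = α * s` is homogeneous in `(r, s)`. -/
lemma travel_smul (hα : 1 < α) (hu : ‖u‖ = 1) {c : ℝ} (hc : 0 ≤ c) :
    travel α 0 (c • r) u = c * travel α 0 r u := by
  symm
  apply eq_travel hα le_rfl hu (norm_nonneg _)
  rw [mul_smul, ← smul_add, norm_smul, norm_add_travel hα le_rfl hu (norm_nonneg _),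
    Real.norm_of_nonneg hc]
  ring

lemma pursuit_smul (hα : 1 < α) (hu : ‖u‖ = 1) {c : ℝ} (hc : 0 < c) :
    pursuit α 0 (c • r) u = pursuit α 0 r u := by
  rw [pursuit, pursuit, travel_smul hα hu hc.le, mul_smul, ← smul_add, smul_smul]
  congr 1
  rw [zero_add, zero_add, mul_left_comm, mul_inv, mul_comm c⁻¹, mul_assoc, inv_mul_cancel₀ hc.ne',
    mul_one]

lemma denom_pos (hα : 1 < α) (hl : 0 ≤ l) (hu : ‖u‖ = 1) (hr : l < ‖r‖) :
    0 < l + α * travel α l r u := by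
  have := travel_pos hα hl hu hr
  positivity

lemma denom_smul_pursuit (h : 0 < l + α * travel α l r u) :
    (l + α * travel α l r u) • pursuit α l r u = r + travel α l r u • u := by
  rw [pursuit, smul_inv_smul₀ h.ne']

lemma norm_pursuit (hα : 1 < α) (hl : 0 ≤ l) (hu : ‖u‖ = 1) (hr : l < ‖r‖) :
    ‖pursuit α l r u‖ = 1 := by
  have h := denom_pos hα hl hu hr
  rw [pursuit, norm_smul, norm_add_travel hα hl hu hr.le, norm_inv, Real.norm_of_nonneg h.le,
    inv_mul_cancel₀ h.ne']

lemma norm_pursuit_le (hα : 1 < α) (hl : 0 ≤ l) (hu : ‖u‖ = 1) :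
    ‖pursuit α l r u‖ ≤ 1 := by
  have h : 0 ≤ l + α * travel α l r u := by
    have : 0 ≤ travel α l r u := travel_nonneg hα
    positivity
  rw [pursuit, norm_smul, norm_inv, Real.norm_of_nonneg h]
  exact inv_mul_le_one_of_le₀ (norm_add_travel_le hα hl hu) h

/-- The denominator `l + α * s` is at least `l`, and `s` is Lipschitz with constant `1 / (α - 1)`.
The constant blows up as `l → 0`, hence the separate treatment of point capture. -/
lemma norm_pursuit_sub_le (hα : 1 < α) (hl : 0 < l) (hu : ‖u‖ = 1) :
    ‖pursuit α l r u - pursuit α l r' u‖ ≤ (1 + (1 + α) / (α - 1)) / l * ‖r - r'‖ := by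
  have hs : 0 ≤ travel α l r u := travel_nonneg hα
  have hs' : 0 ≤ travel α l r' u := travel_nonneg hα
  have h := denom_smul_pursuit (α := α) (l := l) (r := r) (u := u) (by positivity)
  have h' := denom_smul_pursuit (α := α) (l := l) (r := r') (u := u) (by positivity)
  have hg := norm_pursuit_le (r := r') hα hl.le hu
  have hL := mul_abs_travel_sub_le (r := r) (r' := r') hα hl.le hu
  set s := travel α l r u
  set s' := travel α l r' u
  set g := pursuit α l r u
  set g' := pursuit α l r' u
  have h1 : (l + α * s) • (g - g') = (r - r') + (s - s') • u - (α * (s - s')) • g' := by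
    have : (l + α * s) • (g - g')
        = (l + α * s) • g - (l + α * s') • g' - (α * (s - s')) • g' := by module
    rw [this, h, h']; module
  have h2 : ‖(l + α * s) • (g - g')‖ ≤ ‖r - r'‖ + |s - s'| + α * |s - s'| := by
    rw [h1]
    refine (norm_sub_le _ _).trans (add_le_add ((norm_add_le _ _).trans ?_) ?_)
    · rw [norm_smul, hu, mul_one, Real.norm_eq_abs]
    · rw [norm_smul, norm_mul, Real.norm_of_nonneg (by linarith : (0 : ℝ) ≤ α), Real.norm_eq_abs]
      exact mul_le_of_le_one_right (by positivity) hg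
  rw [norm_smul, Real.norm_of_nonneg (by positivity)] at h2
  have h3 : l * ‖g - g'‖ ≤ (l + α * s) * ‖g - g'‖ := by
    apply mul_le_mul_of_nonneg_right _ (norm_nonneg _)
    have : 0 ≤ α * s := by positivity
    linarith
  have h4 : |s - s'| ≤ ‖r - r'‖ / (α - 1) := by
    rw [le_div_iff₀ (by linarith)]; linarith
  have h5 : (1 + α) * |s - s'| ≤ (1 + α) * (‖r - r'‖ / (α - 1)) := by gcongr
  rw [div_mul_eq_mul_div, le_div_iff₀ hl]
  calc ‖g - g'‖ * l ≤ ‖r - r'‖ + (1 + α) * (‖r - r'‖ / (α - 1)) := by linarith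
    _ = _ := by ring

lemma continuous_travel (α l : ℝ) : Continuous fun p : Plane × Plane => travel α l p.1 p.2 := by
  unfold travel
  fun_prop

lemma continuousAt_pursuit {p : Plane × Plane} (h : l + α * travel α l p.1 p.2 ≠ 0) :
    ContinuousAt (fun p : Plane × Plane => pursuit α l p.1 p.2) p := by
  unfold pursuit
  have hc := (continuous_travel α l).continuousAt (x := p)
  exact ((continuousAt_const.add (continuousAt_const.mul hc)).inv₀ h).smul
    (continuousAt_fst.add (hc.smul continuousAt_snd))

/-- Headings differ in angle less than the evader's directions that cause them. -/
lemma inner_le_inner_pursuit (hα : 1 < α) (hl : 0 ≤ l) (hr : l < ‖r‖) (hu : ‖u‖ = 1)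
    (hw : ‖w‖ = 1) : inner ℝ u w ≤ inner ℝ (pursuit α l r u) (pursuit α l r w) := by
  have hs := travel_pos hα hl hu hr
  have ht := travel_pos hα hl hw hr
  have hg := norm_pursuit hα hl hu hr
  have hk := norm_pursuit hα hl hw hr
  have h := denom_smul_pursuit (denom_pos hα hl hu hr)
  have h' := denom_smul_pursuit (denom_pos hα hl hw hr)
  set s := travel α l r u
  set t := travel α l r w
  set g := pursuit α l r u
  set k := pursuit α l r w
  have h1 : (l + α * s) • g - (l + α * t) • k = s • u - t • w := by rw [h, h']; module
  have h2 := congrArg (fun x => ‖x‖ ^ 2) h1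
  simp only [norm_sub_sq_real, norm_smul, inner_smul_left, inner_smul_right, hu, hw, hg, hk,
    mul_one, Real.norm_eq_abs, sq_abs, conj_trivial] at h2
  have h3 : inner ℝ g k ≤ 1 := by
    simpa [hg, hk] using real_inner_le_norm g k
  -- Expanding the squared norms in `h1`, the two sides differ by `(α ^ 2 - 1) * (s - t) ^ 2 / 2`.
  have h4 : (l + α * s) * (l + α * t) * (1 - inner ℝ g k) ≤ s * t * (1 - inner ℝ u w) := by
    have : 0 ≤ (α ^ 2 - 1) * (s - t) ^ 2 := mul_nonneg (sq_sub_one_pos hα).le (sq_nonneg _)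
    nlinarith
  have h5 : s * t ≤ (l + α * s) * (l + α * t) :=
    mul_le_mul (by nlinarith) (by nlinarith) ht.le (by positivity)
  have h6 : s * t * (1 - inner ℝ g k) ≤ s * t * (1 - inner ℝ u w) :=
    (mul_le_mul_of_nonneg_right h5 (by linarith)).trans h4
  linarith [le_of_mul_le_mul_left h6 (by positivity)]

lemma isOpen_dominanceRegion (α l : ℝ) (x₁ x₂ : Plane) : IsOpen (dominanceRegion α l x₁ x₂) :=
  isOpen_lt continuous_const (by fun_prop)

/-- A frontier point has zero excess, which determines `s`. Conversely, the points of the ray before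
the root have positive excess and accumulate at the root, which itself lies outside the open region.
-/
lemma isAimPoint_iff (hα : 1 < α) (hl : 0 ≤ l) {xp xe x : Plane} (h : l < ‖xp - xe‖)
    (hu : ‖u‖ = 1) :
    IsAimPoint α l xp xe u x ↔ x = xe + travel α l (xe - xp) u • u := by
  rw [norm_sub_rev] at h
  have key : ∀ s : ℝ, xe + s • u - xp = (xe - xp) + s • u := fun s => by abel
  have key2 : ∀ s : ℝ, 0 ≤ s → ‖xe + s • u - xe‖ = s := fun s hs => by
    rw [add_sub_cancel_left, norm_smul, hu, mul_one, Real.norm_of_nonneg hs]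
  have hs : 0 < travel α l (xe - xp) u := travel_pos hα hl hu h
  constructor
  · rintro ⟨⟨s, hs, rfl⟩, hx⟩
    have h1 : xe + s • u ∈ {x | ‖x - xp‖ - α * ‖x - xe‖ = l} := by
      have := frontier_lt_subset_eq (f := fun _ : Plane => l)
        (g := fun x : Plane => ‖x - xp‖ - α * ‖x - xe‖) (by fun_prop) (by fun_prop) hx
      exact this.symm
    rw [mem_ofPred_eq, key, key2 s hs] at h1
    exact congrArg (fun σ : ℝ => xe + σ • u) (eq_travel hα hl hu h.le (by linarith))
  · rintro rfl
    refine ⟨⟨_, hs.le, rfl⟩, ?_⟩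
    rw [(isOpen_dominanceRegion α l xp xe).frontier_eq]
    refine ⟨?_, ?_⟩
    · set s := travel α l (xe - xp) u
      have hc : ContinuousWithinAt (fun σ : ℝ => xe + σ • u) (Ico 0 s) s := by fun_prop
      refine hc.mem_closure ?_ ?_
      · rw [closure_Ico hs.ne]; exact right_mem_Icc.2 hs.le
      · intro σ hσ
        have := mul_travel_sub_le hα hl hu h.le hσ.2.le
        simp only [dominanceRegion, mem_ofPred_eq, key, key2 σ hσ.1]
        have h2 : 0 < (α - 1) * (s - σ) := mul_pos (by linarith) (by linarith [hσ.2])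
        linarith
    · simp only [dominanceRegion, mem_ofPred_eq, key, key2 _ hs.le, norm_add_travel hα hl hu h.le]
      linarith

lemma existsUnique_isAimPoint (hα : 1 < α) (hl : 0 ≤ l) {xp xe : Plane} (h : l < ‖xp - xe‖)
    (hu : ‖u‖ = 1) : ∃! x, IsAimPoint α l xp xe u x := by
  simp only [isAimPoint_iff hα hl h hu]
  exact existsUnique_eq

lemma heading_eq_pursuit (hα : 1 < α) (hl : 0 ≤ l) {xp xe : Plane} (h : l < ‖xp - xe‖)
    (hu : ‖u‖ = 1) : heading α l xp xe u = pursuit α l (xe - xp) u := by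
  have h1 : aimPoint α l xp xe u = xe + travel α l (xe - xp) u • u :=
    (isAimPoint_iff hα hl h hu).1
      (Classical.epsilon_spec (existsUnique_isAimPoint hα hl h hu).exists)
  have h2 : xe + travel α l (xe - xp) u • u - xp = (xe - xp) + travel α l (xe - xp) u • u := by
    abel
  rw [norm_sub_rev] at h
  rw [heading, h1, h2, norm_add_travel hα hl hu h.le, pursuit]

attribute [irreducible] travel pursuit

end

/-! ### Piecewise continuous controls and their trajectories -/

section

variable {t₀ : ℝ} {u f g : ℝ → Plane}

lemma PiecewiseContinuous.aestronglyMeasurable (hf : PiecewiseContinuous t₀ f) (T : ℝ) :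
    AEStronglyMeasurable f (volume.restrict (Icc t₀ T)) := by
  set N := {t | t ∈ Icc t₀ T ∧ ¬ ContinuousWithinAt f (Ici t₀) t}
  have hN : N.Finite := hf.1 T
  have hc : ContinuousOn f (Icc t₀ T \ N) := by
    intro t ht
    have h1 : ContinuousWithinAt f (Ici t₀) t := by
      by_contra h
      exact ht.2 ⟨ht.1, h⟩
    exact h1.mono fun s hs => hs.1.1
  have h2 := hc.aestronglyMeasurable (μ := volume) (measurableSet_Icc.diff hN.measurableSet)
  rwa [Measure.restrict_congr_set (sdiff_null_ae_eq_self (hN.measure_zero _))] at h2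

lemma PiecewiseContinuous.intervalIntegrable (hf : PiecewiseContinuous t₀ f) {M : ℝ}
    (hM : ∀ t, t₀ ≤ t → ‖f t‖ ≤ M) {a b : ℝ} (ha : t₀ ≤ a) (hb : t₀ ≤ b) :
    IntervalIntegrable f volume a b := by
  have key : ∀ T, IntegrableOn f (Icc t₀ T) := fun T => by
    refine IntegrableOn.of_bound measure_Icc_lt_top (hf.aestronglyMeasurable T) M ?_
    filter_upwards [ae_restrict_mem measurableSet_Icc] with t ht using hM t ht.1
  rw [intervalIntegrable_iff]
  exact (key (max a b)).mono_set fun t ht => ⟨(le_min ha hb).trans ht.1.le, ht.2⟩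

lemma Controls.intervalIntegrable (hu : u ∈ Controls t₀) {a b : ℝ} (ha : t₀ ≤ a) (hb : t₀ ≤ b) :
    IntervalIntegrable u volume a b :=
  hu.2.intervalIntegrable (fun t ht => (hu.1 t ht).le) ha hb

lemma continuousOn_traj (v : ℝ) (x : Plane) (hu : u ∈ Controls t₀) :
    ContinuousOn (traj v t₀ x u) (Ici t₀) := by
  intro t ht
  have ht' : t₀ ≤ t := ht
  have h1 : IntervalIntegrable (fun s => v • u s) volume t₀ (t + 1) :=
    (Controls.intervalIntegrable hu le_rfl (by linarith)).smul v
  have h2 := intervalIntegral.continuousOn_primitive_interval' h1 left_mem_uIcc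
  rw [uIcc_of_le (by linarith)] at h2
  have h3 : ContinuousWithinAt (traj v t₀ x u) (Icc t₀ (t + 1)) t :=
    (h2 t ⟨ht', by linarith⟩).const_add x
  refine h3.mono_of_mem_nhdsWithin ?_
  filter_upwards [self_mem_nhdsWithin, mem_nhdsWithin_of_mem_nhds (Iio_mem_nhds (lt_add_one t))]
    with s hs hs' using ⟨hs, le_of_lt hs'⟩

/-- Right derivatives exist even at switching times, because right limits of the control do; the
comparison arguments need no more. -/
lemma hasDerivWithinAt_traj (v : ℝ) (x : Plane) (hu : u ∈ Controls t₀) {t : ℝ} (ht : t₀ ≤ t)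
    {a : Plane} (ha : Tendsto u (𝓝[>] t) (𝓝 a)) :
    HasDerivWithinAt (traj v t₀ x u) (v • a) (Ici t) t := by
  have h1 : IntervalIntegrable (fun s => v • u s) volume t₀ t :=
    (Controls.intervalIntegrable hu le_rfl ht).smul v
  have hm : StronglyMeasurableAtFilter (fun s => v • u s) (𝓝[>] t) := by
    refine ⟨Ioc t (t + 1), Ioc_mem_nhdsGT (lt_add_one t), ?_⟩
    have hsub : Ioc t (t + 1) ⊆ Icc t₀ (t + 1) := fun s hs => ⟨ht.trans hs.1.le, hs.2⟩
    exact ((hu.2.aestronglyMeasurable (t + 1)).mono_set hsub).const_smul v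
  exact (intervalIntegral.integral_hasDerivWithinAt_of_tendsto_ae_right h1 hm
    ((ha.const_smul v).mono_left inf_le_left)).const_add x

lemma norm_eq_one_of_tendsto (hu : u ∈ Controls t₀) {t : ℝ} (ht : t₀ ≤ t) {a : Plane}
    (ha : Tendsto u (𝓝[>] t) (𝓝 a)) : ‖a‖ = 1 := by
  refine tendsto_nhds_unique ha.norm (tendsto_const_nhds.congr' ?_)
  filter_upwards [self_mem_nhdsWithin] with s hs
  exact (hu.1 s (ht.trans (le_of_lt hs))).symm

lemma PiecewiseContinuous.comp_continuous {h : ℝ × Plane → Plane} (hh : Continuous h)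
    (hf : PiecewiseContinuous t₀ f) : PiecewiseContinuous t₀ fun t => h (t, f t) := by
  have key : ∀ {F : Filter ℝ} {t : ℝ} {a : Plane}, F ≤ 𝓝 t → Tendsto f F (𝓝 a) →
      Tendsto (fun t => h (t, f t)) F (𝓝 (h (t, a))) := fun hF ha =>
    (hh.tendsto _).comp ((tendsto_id.mono_right hF).prodMk_nhds ha)
  refine ⟨fun T => (hf.1 T).subset ?_, fun t ht => ?_, fun t ht => ?_⟩
  · rintro t ⟨ht, hd⟩
    exact ⟨ht, fun hc => hd (key inf_le_left hc)⟩
  · obtain ⟨a, ha⟩ := hf.2.1 t ht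
    exact ⟨_, key inf_le_left ha⟩
  · obtain ⟨a, ha⟩ := hf.2.2 t ht
    exact ⟨_, key inf_le_left ha⟩

lemma piecewiseContinuous_const (t₀ : ℝ) (e : Plane) : PiecewiseContinuous t₀ fun _ => e :=
  ⟨fun T => by simp [continuousWithinAt_const], fun _ _ => ⟨e, tendsto_const_nhds⟩,
    fun _ _ => ⟨e, tendsto_const_nhds⟩⟩

lemma PiecewiseContinuous.congr (hf : PiecewiseContinuous t₀ f) (h : ∀ t, t₀ ≤ t → g t = f t) :
    PiecewiseContinuous t₀ g := by
  refine ⟨fun T => (hf.1 T).subset ?_, fun t ht => ?_, fun t ht => ?_⟩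
  · rintro t ⟨ht, hd⟩
    exact ⟨ht, fun hc => hd (hc.congr (fun s hs => h s hs) (h t ht.1))⟩
  · obtain ⟨a, ha⟩ := hf.2.1 t ht
    refine ⟨a, ha.congr' ?_⟩
    filter_upwards [self_mem_nhdsWithin] with s hs using (h s (ht.trans (le_of_lt hs))).symm
  · obtain ⟨a, ha⟩ := hf.2.2 t ht
    refine ⟨a, ha.congr' ?_⟩
    filter_upwards [mem_nhdsWithin_of_mem_nhds (Ioi_mem_nhds ht)] with s hs
    exact (h s (le_of_lt hs)).symm

open Classical in
/-- Piecewise continuity is preserved by a switch at time `T`. -/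
lemma PiecewiseContinuous.ite_lt (hf : PiecewiseContinuous t₀ f) (hg : PiecewiseContinuous t₀ g)
    (T : ℝ) : PiecewiseContinuous t₀ fun t => if t < T then f t else g t := by
  have lt : ∀ {t}, t < T → (fun t => if t < T then f t else g t) =ᶠ[𝓝 t] f := fun h => by
    filter_upwards [Iio_mem_nhds h] with s hs using if_pos hs
  have gt : ∀ {t}, T < t → (fun t => if t < T then f t else g t) =ᶠ[𝓝 t] g := fun h => by
    filter_upwards [Ioi_mem_nhds h] with s hs using if_neg (not_lt.2 (le_of_lt hs))
  refine ⟨fun S => ?_, fun t ht => ?_, fun t ht => ?_⟩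
  · refine (((hf.1 S).union (hg.1 S)).union (finite_singleton T)).subset ?_
    rintro t ⟨ht, hd⟩
    rcases lt_trichotomy t T with h | h | h
    · exact Or.inl (Or.inl ⟨ht, fun hc =>
        hd (hc.congr_of_eventuallyEq ((lt h).filter_mono inf_le_left) (lt h).self_of_nhds)⟩)
    · exact Or.inr h
    · exact Or.inl (Or.inr ⟨ht, fun hc =>
        hd (hc.congr_of_eventuallyEq ((gt h).filter_mono inf_le_left) (gt h).self_of_nhds)⟩)
  · rcases lt_or_ge t T with h | h
    · obtain ⟨a, ha⟩ := hf.2.1 t ht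
      exact ⟨a, ha.congr' ((lt h).filter_mono inf_le_left).symm⟩
    · obtain ⟨a, ha⟩ := hg.2.1 t ht
      refine ⟨a, ha.congr' ?_⟩
      filter_upwards [self_mem_nhdsWithin] with s hs
      exact (if_neg (not_lt.2 (h.trans (le_of_lt hs)))).symm
  · rcases le_or_gt t T with h | h
    · obtain ⟨a, ha⟩ := hf.2.2 t ht
      refine ⟨a, ha.congr' ?_⟩
      filter_upwards [self_mem_nhdsWithin] with s hs
      exact (if_pos (lt_of_lt_of_le hs h)).symm
    · obtain ⟨a, ha⟩ := hg.2.2 t ht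
      exact ⟨a, ha.congr' ((gt h).filter_mono inf_le_left).symm⟩

end

/-! ### Picard existence and uniqueness for integral equations -/

section

lemma integral_exp_mul_shift {k : ℝ} (hk : k ≠ 0) (a t : ℝ) :
    ∫ s in a..t, Real.exp (k * (s - a)) = (Real.exp (k * (t - a)) - 1) / k := by
  have h : ∀ s ∈ uIcc a t, HasDerivAt (fun s => Real.exp (k * (s - a)) / k)
      (Real.exp (k * (s - a))) s := fun s _ => by
    have h1 : HasDerivAt (fun s => k * (s - a)) k s := by
      simpa using ((hasDerivAt_id s).sub_const a).const_mul k
    have := h1.exp.div_const k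
    rwa [mul_div_assoc, div_self hk, mul_one] at this
  rw [intervalIntegral.integral_eq_sub_of_hasDerivAt h
    (Continuous.intervalIntegrable (by fun_prop) _ _)]
  simp [sub_div]

variable {E : Type*} [NormedAddCommGroup E] [NormedSpace ℝ E]

/-- A weighted integral estimate: this makes the Picard operator a contraction. -/
lemma norm_integral_le_exp_half {K m a t : ℝ} (hK : 0 < K) (hm : 0 ≤ m) (hat : a ≤ t) {f : ℝ → E}
    (hf : ∀ᵐ s, s ∈ Ioc a t → ‖f s‖ ≤ K * (m * Real.exp (2 * K * (s - a)))) :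
    ‖∫ s in a..t, f s‖ ≤ m / 2 * Real.exp (2 * K * (t - a)) := by
  have h1 := intervalIntegral.norm_integral_le_of_norm_le hat
    (g := fun s => K * (m * Real.exp (2 * K * (s - a)))) hf
    (Continuous.intervalIntegrable (by fun_prop) _ _)
  refine h1.trans ?_
  rw [intervalIntegral.integral_const_mul, intervalIntegral.integral_const_mul,
    integral_exp_mul_shift (by positivity)]
  have : K * (m * ((Real.exp (2 * K * (t - a)) - 1) / (2 * K)))
      = m / 2 * Real.exp (2 * K * (t - a)) - m / 2 := by field_simp
  linarith

/-- Existence for `r' = F t r` with `F` bounded and Lipschitz in `r`, and measurable in time along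
continuous curves, in integral form. -/
lemma exists_integral_solution [CompleteSpace E] {F : ℝ → E → E} {K M t₀ : ℝ} (hK : 0 < K)
    (r₀ : E)
    (hM : ∀ t, t₀ ≤ t → ∀ x, ‖F t x‖ ≤ M)
    (hL : ∀ t, t₀ ≤ t → ∀ x y, ‖F t x - F t y‖ ≤ K * ‖x - y‖)
    (hI : ∀ r : ℝ → E, Continuous r → ∀ a b, t₀ ≤ a → t₀ ≤ b →
      IntervalIntegrable (fun s => F s (r s)) volume a b) :
    ∃ r : ℝ → E, Continuous r ∧ ∀ t, t₀ ≤ t → r t = r₀ + ∫ s in t₀..t, F s (r s) := by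
  have hM0 : 0 ≤ M := (norm_nonneg _).trans (hM t₀ le_rfl 0)
  -- Clamping time at `t₀` defines the operator on functions on all of `ℝ`, while `F` is controlled
  -- only from `t₀` on.
  let c : ℝ → ℝ := fun t => max t t₀
  have hc : Continuous c := by fun_prop
  have hct : ∀ t, t₀ ≤ c t := fun t => le_max_right _ _
  let e : ℝ → ℝ := fun t => Real.exp (2 * K * (t - t₀))
  have he : Continuous e := by fun_prop
  have he0 : ∀ t, 0 < e t := fun t => Real.exp_pos _
  -- The unknown is `φ = (r - r₀) / e`; the exponent `2 * K` in the weight yields the contraction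
  -- factor `1 / 2`.
  let R : BoundedContinuousFunction ℝ E → ℝ → E := fun φ t => r₀ + e t • φ t
  have hR : ∀ φ, Continuous (R φ) := fun φ => by
    have := φ.continuous
    fun_prop
  let P : BoundedContinuousFunction ℝ E → ℝ → E := fun φ t =>
    (e (c t))⁻¹ • ∫ s in t₀..c t, F s (R φ s)
  have hPc : ∀ φ, Continuous (P φ) := fun φ => by
    have h1 : ContinuousOn (fun t => ∫ s in t₀..t, F s (R φ s)) (Ici t₀) := by
      have hlip : LipschitzOnWith ⟨M, hM0⟩ (fun t => ∫ s in t₀..t, F s (R φ s)) (Ici t₀) := by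
        refine LipschitzOnWith.of_dist_le_mul fun x hx y hy => ?_
        rw [dist_eq_norm, intervalIntegral.integral_interval_sub_left
          (hI _ (hR φ) _ _ le_rfl hx) (hI _ (hR φ) _ _ le_rfl hy), Real.dist_eq]
        refine intervalIntegral.norm_integral_le_of_norm_le_const fun s hs => ?_
        exact hM s ((le_min hy hx).trans hs.1.le) _
      exact hlip.continuousOn
    have h2 : Continuous fun t => ∫ s in t₀..c t, F s (R φ s) :=
      h1.comp_continuous hc hct
    exact ((he.comp hc).inv₀ fun t => (he0 _).ne').smul h2
  have hPb : ∀ φ t, ‖P φ t‖ ≤ M / (2 * K) := fun φ t => by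
    have h1 : ‖∫ s in t₀..c t, F s (R φ s)‖ ≤ M * |c t - t₀| :=
      intervalIntegral.norm_integral_le_of_norm_le_const fun s hs =>
        hM s (by rw [uIoc_of_le (hct t)] at hs; exact hs.1.le) _
    rw [abs_of_nonneg (sub_nonneg.2 (hct t))] at h1
    have h2 : 2 * K * (c t - t₀) ≤ e (c t) := by
      have := Real.add_one_le_exp (2 * K * (c t - t₀))
      simp only [e]
      linarith
    rw [norm_smul, norm_inv, Real.norm_of_nonneg (he0 _).le, inv_mul_le_iff₀ (he0 _)]
    calc _ ≤ M * (c t - t₀) := h1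
      _ = M / (2 * K) * (2 * K * (c t - t₀)) := by field_simp
      _ ≤ M / (2 * K) * e (c t) := by gcongr
      _ = _ := by ring
  let Φ : BoundedContinuousFunction ℝ E → BoundedContinuousFunction ℝ E := fun φ =>
    BoundedContinuousFunction.ofNormedAddCommGroup (P φ) (hPc φ) _ (hPb φ)
  have hΦ : ContractingWith (1 / 2) Φ := by
    refine ⟨by norm_num, LipschitzWith.of_dist_le_mul fun φ ψ => ?_⟩
    refine (BoundedContinuousFunction.dist_le (by positivity)).2 fun t => ?_
    change dist (P φ t) (P ψ t) ≤ _
    rw [dist_eq_norm, ← smul_sub, ← intervalIntegral.integral_sub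
      (hI _ (hR φ) _ _ le_rfl (hct t)) (hI _ (hR ψ) _ _ le_rfl (hct t)), norm_smul, norm_inv,
      Real.norm_of_nonneg (he0 _).le, inv_mul_le_iff₀ (he0 _)]
    refine (norm_integral_le_exp_half hK (dist_nonneg (x := φ) (y := ψ)) (hct t)
      (ae_of_all _ fun s hs => ?_)).trans (le_of_eq ?_)
    · refine (hL s hs.1.le _ _).trans (mul_le_mul_of_nonneg_left ?_ hK.le)
      change ‖r₀ + e s • φ s - (r₀ + e s • ψ s)‖ ≤ _
      rw [add_sub_add_left_eq_sub, ← smul_sub, norm_smul, Real.norm_of_nonneg (he0 _).le, mul_comm,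
        ← dist_eq_norm]
      exact mul_le_mul_of_nonneg_right (φ.dist_coe_le_dist s) (he0 _).le
    · simp only [e]
      push_cast
      ring
  obtain ⟨φ, hφ⟩ : ∃ φ, Φ φ = φ := ⟨hΦ.fixedPoint, hΦ.fixedPoint_isFixedPt⟩
  refine ⟨R φ, hR φ, fun t ht => ?_⟩
  have h1 : P φ t = φ t := congrArg (fun ψ : BoundedContinuousFunction ℝ E => ψ t) hφ
  have h2 : (e t)⁻¹ • ∫ s in t₀..t, F s (R φ s) = φ t := by
    rw [← h1]
    simp only [P, c, max_eq_left ht]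
  change r₀ + e t • φ t = _
  rw [← h2, smul_inv_smul₀ (he0 t).ne']

/-- Uniqueness for the same integral equation. -/
lemma eq_of_sub_eq_integral {r r' F G : ℝ → E} {K t₀ T : ℝ} (hK : 0 < K)
    (hr : Continuous r) (hr' : Continuous r')
    (hd : ∀ t ∈ Icc t₀ T, r t - r' t = ∫ s in t₀..t, (F s - G s))
    (hL : ∀ᵐ t ∂(volume.restrict (Icc t₀ T)), ‖F t - G t‖ ≤ K * ‖r t - r' t‖) :
    ∀ t ∈ Icc t₀ T, r t = r' t := by
  intro t ht
  have hc : Continuous fun t => ‖r t - r' t‖ * Real.exp (-(2 * K * (t - t₀))) := by fun_prop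
  -- At the maximum `m` of the weighted difference, the integral estimate gives `m ≤ m / 2`.
  obtain ⟨τ, hτ, hmax⟩ := isCompact_Icc.exists_isMaxOn ⟨t, ht⟩ hc.continuousOn
  set m := ‖r τ - r' τ‖ * Real.exp (-(2 * K * (τ - t₀))) with hm
  have hm0 : 0 ≤ m := by positivity
  have hle : ∀ s ∈ Icc t₀ T, ‖r s - r' s‖ ≤ m * Real.exp (2 * K * (s - t₀)) := fun s hs => by
    have h1 : ‖r s - r' s‖ * Real.exp (-(2 * K * (s - t₀))) ≤ m := hmax hs
    rw [Real.exp_neg] at h1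
    exact (mul_inv_le_iff₀ (Real.exp_pos _)).1 h1
  have h2 : ‖r τ - r' τ‖ ≤ m / 2 * Real.exp (2 * K * (τ - t₀)) := by
    rw [hd τ hτ]
    refine norm_integral_le_exp_half hK hm0 hτ.1 ?_
    filter_upwards [(ae_restrict_iff' measurableSet_Icc).1 hL] with s hs hsτ
    have hs' : s ∈ Icc t₀ T := ⟨hsτ.1.le, hsτ.2.trans hτ.2⟩
    exact (hs hs').trans (mul_le_mul_of_nonneg_left (hle s hs') hK.le)
  have h3 : m ≤ m / 2 := by
    nth_rewrite 1 [hm]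
    rw [Real.exp_neg]
    exact (mul_inv_le_iff₀ (Real.exp_pos _)).2 h2
  have h4 := hle t ht
  have h5 : m = 0 := by linarith
  rw [h5, zero_mul] at h4
  exact sub_eq_zero.1 (norm_le_zero_iff.1 h4)

end

/-! ### Existence of the strategy -/

section

variable {α l t₀ : ℝ} {xp₀ xe₀ : Plane} {u up : ℝ → Plane}

lemma lt_norm_of_lt_terminalTime {t : ℝ}
    (h : (t : EReal) < terminalTime α l t₀ xp₀ xe₀ up u) {τ : ℝ} (hτ : τ ∈ Icc t₀ t) :
    l < ‖traj α t₀ xp₀ up τ - traj 1 t₀ xe₀ u τ‖ := by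
  by_contra hle
  have h1 : terminalTime α l t₀ xp₀ xe₀ up u ≤ (τ : EReal) :=
    sInf_le ⟨τ, ⟨hτ.1, not_lt.1 hle⟩, rfl⟩
  exact absurd (h.trans_le (h1.trans (EReal.coe_le_coe_iff.2 hτ.2))) (lt_irrefl _)

lemma traj_sub_traj (hu : u ∈ Controls t₀) (hp : up ∈ Controls t₀) {t : ℝ} (ht : t₀ ≤ t) :
    traj 1 t₀ xe₀ u t - traj α t₀ xp₀ up t
      = (xe₀ - xp₀) + ∫ s in t₀..t, (u s - α • up s) := by
  have hp' : IntervalIntegrable (fun s => α • up s) volume t₀ t :=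
    (Controls.intervalIntegrable hp le_rfl ht).smul α
  rw [intervalIntegral.integral_sub (Controls.intervalIntegrable hu le_rfl ht) hp', traj, traj]
  simp only [one_smul]
  abel

/-- Omitting the right endpoint lets the interval end at the capture time, where the feedback law
may fail. -/
lemma integral_congr_of_Ico {f g : ℝ → Plane} {t : ℝ} (ht : t₀ ≤ t)
    (h : ∀ s ∈ Ico t₀ t, f s = g s) : ∫ s in t₀..t, f s = ∫ s in t₀..t, g s := by
  rw [intervalIntegral.integral_of_le ht, intervalIntegral.integral_of_le ht,
    ← integral_Ico_eq_integral_Ioc, ← integral_Ico_eq_integral_Ioc]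
  exact setIntegral_congr_fun measurableSet_Ico h

lemma continuous_pursuit (hα : 1 < α) (hl : 0 < l) :
    Continuous fun p : Plane × Plane => pursuit α l p.1 p.2 :=
  continuous_iff_continuousAt.2 fun p => continuousAt_pursuit (by
    have : 0 ≤ travel α l p.1 p.2 := travel_nonneg hα
    positivity)

lemma piecewiseContinuous_pursuit (hα : 1 < α) (hl : 0 < l) (hu : PiecewiseContinuous t₀ u)
    {r : ℝ → Plane} (hr : Continuous r) :
    PiecewiseContinuous t₀ fun t => pursuit α l (r t) (u t) :=
  hu.comp_continuous (h := fun p => pursuit α l (r p.1) p.2)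
    ((continuous_pursuit hα hl).comp ((hr.comp continuous_fst).prodMk continuous_snd))

lemma intervalIntegrable_relative_velocity (hα : 1 < α) (hl : 0 < l) (hu : u ∈ Controls t₀)
    {r : ℝ → Plane} (hr : Continuous r) {a b : ℝ} (ha : t₀ ≤ a) (hb : t₀ ≤ b) :
    IntervalIntegrable (fun s => u s - α • pursuit α l (r s) (u s)) volume a b :=
  (Controls.intervalIntegrable hu ha hb).sub
    (((piecewiseContinuous_pursuit hα hl hu.2 hr).intervalIntegrable
      (fun t ht => norm_pursuit_le hα hl.le (hu.1 t ht)) ha hb).smul α)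

/-- The closed-loop relative motion, extended into the capture disc. -/
lemma exists_relative_motion (hα : 1 < α) (hl : 0 < l) (hu : u ∈ Controls t₀) (r₀ : Plane) :
    ∃ r : ℝ → Plane, Continuous r ∧
      ∀ t, t₀ ≤ t → r t = r₀ + ∫ s in t₀..t, (u s - α • pursuit α l (r s) (u s)) := by
  have hα0 : 0 < α := by linarith
  have hbound : ∀ t, t₀ ≤ t → ∀ x, ‖u t - α • pursuit α l x (u t)‖ ≤ 1 + α := fun t ht x => by
    refine (norm_sub_le _ _).trans (add_le_add (hu.1 t ht).le ?_)
    rw [norm_smul, Real.norm_of_nonneg hα0.le]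
    exact mul_le_of_le_one_right hα0.le (norm_pursuit_le hα hl.le (hu.1 t ht))
  have hα1 : 0 < α - 1 := by linarith
  refine exists_integral_solution (F := fun t x => u t - α • pursuit α l x (u t))
    (K := α * ((1 + (1 + α) / (α - 1)) / l)) (M := 1 + α) (by positivity) r₀ hbound
    (fun t ht x y => ?_)
    (fun r hr a b ha hb => intervalIntegrable_relative_velocity hα hl hu hr ha hb)
  rw [sub_sub_sub_cancel_left, ← smul_sub, norm_smul, Real.norm_of_nonneg hα0.le, mul_assoc,
    norm_sub_rev x y]
  exact mul_le_mul_of_nonneg_left (norm_pursuit_sub_le hα hl (hu.1 t ht)) hα0.le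

/-- The relative motion up to time `T` depends on the evader's control up to time `T` only. -/
lemma relative_motion_eq (hα : 1 < α) (hl : 0 < l) {u' r r' : ℝ → Plane} {r₀ : Plane} {T : ℝ}
    (hu : u ∈ Controls t₀) (hu' : u' ∈ Controls t₀) (hrc : Continuous r) (hrc' : Continuous r')
    (hr : ∀ t, t₀ ≤ t → r t = r₀ + ∫ s in t₀..t, (u s - α • pursuit α l (r s) (u s)))
    (hr' : ∀ t, t₀ ≤ t → r' t = r₀ + ∫ s in t₀..t, (u' s - α • pursuit α l (r' s) (u' s)))
    (h : ∀ᵐ t ∂(volume.restrict (Icc t₀ T)), u t = u' t) :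
    ∀ t ∈ Icc t₀ T, r t = r' t := by
  have hα0 : 0 < α := by linarith
  have hα1 : 0 < α - 1 := by linarith
  refine eq_of_sub_eq_integral (K := α * ((1 + (1 + α) / (α - 1)) / l)) (by positivity) hrc hrc'
    (F := fun s => u s - α • pursuit α l (r s) (u s))
    (G := fun s => u' s - α • pursuit α l (r' s) (u' s)) (fun t ht => ?_) ?_
  · rw [intervalIntegral.integral_sub
      (intervalIntegrable_relative_velocity hα hl hu hrc le_rfl ht.1)
      (intervalIntegrable_relative_velocity hα hl hu' hrc' le_rfl ht.1), hr t ht.1,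
      hr' t ht.1, add_sub_add_left_eq_sub]
  · filter_upwards [h, ae_restrict_mem measurableSet_Icc] with t ht htI
    rw [← ht, sub_sub_sub_cancel_left, ← smul_sub, norm_smul, Real.norm_of_nonneg hα0.le,
      mul_assoc, norm_sub_rev (r t)]
    exact mul_le_mul_of_nonneg_left (norm_pursuit_sub_le hα hl (hu.1 t htI.1)) hα0.le

/-- A continuous curve either stays outside the disc of radius `l` or has a first hitting time. -/
lemma first_hitting_time {r : ℝ → Plane} (hr : Continuous r) (l t₀ : ℝ) :
    (∀ t, ∀ τ ∈ Icc t₀ t, l < ‖r τ‖) ∨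
      ∃ T, t₀ ≤ T ∧ ‖r T‖ ≤ l ∧ ∀ t, (∀ τ ∈ Icc t₀ t, l < ‖r τ‖) ↔ t < T := by
  set S := {t | t₀ ≤ t ∧ ‖r t‖ ≤ l} with hS
  have hcl : IsClosed S :=
    (isClosed_le continuous_const continuous_id).inter (isClosed_le hr.norm continuous_const)
  have hbdd : BddBelow S := ⟨t₀, fun t ht => ht.1⟩
  rcases S.eq_empty_or_nonempty with hE | hne
  · refine Or.inl fun t τ hτ => ?_
    by_contra h
    have : τ ∈ S := ⟨hτ.1, not_lt.1 h⟩
    simp [hE] at this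
  · have hT : sInf S ∈ S := hcl.csInf_mem hne hbdd
    refine Or.inr ⟨sInf S, hT.1, hT.2, fun t => ⟨fun h => ?_, fun h τ hτ => ?_⟩⟩
    · by_contra hlt
      exact absurd (h _ ⟨hT.1, not_lt.1 hlt⟩) (not_lt.2 hT.2)
    · by_contra hle
      exact absurd (csInf_le hbdd ⟨hτ.1, not_lt.1 hle⟩) (not_le.2 (hτ.2.trans_lt h))

lemma exists_unit_vector : ∃ e : Plane, ‖e‖ = 1 := exists_norm_eq Plane zero_le_one

open Classical in
lemma exists_isDeltaStar_of_pos (hα : 1 < α) (hl : 0 < l) (xp₀ xe₀ : Plane) (t₀ : ℝ) :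
    ∃ δ, IsDeltaStar α l t₀ xp₀ xe₀ δ := by
  obtain ⟨e, he⟩ := exists_unit_vector
  choose ρ hρc hρ using fun u : Controls t₀ =>
    exists_relative_motion hα hl u.2 (xe₀ - xp₀)
  let ctrl : Controls t₀ → ℝ → Plane := fun u t =>
    if ∀ τ ∈ Icc t₀ t, l < ‖ρ u τ‖ then pursuit α l (ρ u t) (u.1 t) else e
  have hctrl : ∀ u, ctrl u ∈ Controls t₀ := fun u => by
    refine ⟨fun t ht => ?_, ?_⟩
    · by_cases h : ∀ τ ∈ Icc t₀ t, l < ‖ρ u τ‖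
      · rw [show ctrl u t = _ from if_pos h]
        exact norm_pursuit hα hl.le (u.2.1 t ht) (h t ⟨ht, le_rfl⟩)
      · rw [show ctrl u t = _ from if_neg h, he]
    · have hpc := piecewiseContinuous_pursuit hα hl u.2.2 (hρc u)
      rcases first_hitting_time (hρc u) l t₀ with h | ⟨T, -, -, hT⟩
      · exact hpc.congr fun t _ => if_pos (h t)
      · refine (hpc.ite_lt (piecewiseContinuous_const t₀ e) T).congr fun t _ => ?_
        simp only [ctrl, hT]
  refine ⟨fun u => ⟨ctrl u, hctrl u⟩, fun t' _ u u' h => ?_, fun u t ht htf => ?_⟩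
  · have hEq := relative_motion_eq hα hl u.2 u'.2 (hρc u) (hρc u') (hρ u) (hρ u') h
    filter_upwards [h, ae_restrict_mem measurableSet_Icc] with t htu htI
    have hiff : (∀ τ ∈ Icc t₀ t, l < ‖ρ u τ‖) ↔ ∀ τ ∈ Icc t₀ t, l < ‖ρ u' τ‖ :=
      forall₂_congr fun τ hτ => by rw [hEq τ ⟨hτ.1, hτ.2.trans htI.2⟩]
    simp only [ctrl, hiff, htu, hEq t htI]
  -- The true relative motion agrees with `ρ u` up to and including the first hitting time of `ρ u`,
  -- so that hitting would be a genuine capture.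
  · have hrel : ∀ s, t₀ ≤ s → (∀ σ ∈ Ico t₀ s, ∀ τ ∈ Icc t₀ σ, l < ‖ρ u τ‖) →
        traj 1 t₀ xe₀ u.1 s - traj α t₀ xp₀ (ctrl u) s = ρ u s := fun s hs hσ => by
      rw [traj_sub_traj u.2 (hctrl u) hs, hρ u s hs]
      congr 1
      refine integral_congr_of_Ico hs fun σ h => ?_
      rw [show ctrl u σ = _ from if_pos (hσ σ h)]
    have halive : ∀ τ ∈ Icc t₀ t, l < ‖ρ u τ‖ := by
      rcases first_hitting_time (hρc u) l t₀ with h | ⟨T, hT0, hTl, hT⟩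
      · exact h t
      · rw [hT]
        by_contra hle
        have h1 := lt_norm_of_lt_terminalTime htf ⟨hT0, not_lt.1 hle⟩
        rw [norm_sub_rev, hrel T hT0 fun σ hσ => (hT σ).2 hσ.2] at h1
        exact absurd h1 (not_lt.2 hTl)
    change ctrl u t = heading α l (traj α t₀ xp₀ (ctrl u) t) _ _
    rw [heading_eq_pursuit hα hl.le (lt_norm_of_lt_terminalTime htf ⟨ht, le_rfl⟩) (u.2.1 t ht),
      hrel t ht fun σ hσ τ hτ => halive τ ⟨hτ.1, hτ.2.trans hσ.2.le⟩]
    exact if_pos halive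

/-- For point capture the line of sight keeps its direction. -/
lemma exists_isDeltaStar_zero (hα : 1 < α) (h₀ : 0 < ‖xp₀ - xe₀‖) :
    ∃ δ, IsDeltaStar α 0 t₀ xp₀ xe₀ δ := by
  set r₀ := xe₀ - xp₀ with hr₀
  have hr : 0 < ‖r₀‖ := by rwa [norm_sub_rev] at h₀
  have hden : ∀ v : Plane, 0 < travel α 0 r₀ v := fun v => travel_zero_pos hα (norm_pos_iff.1 hr)
  have hα0 : 0 < α := by linarith
  have hc : Continuous fun p : ℝ × Plane => pursuit α 0 r₀ p.2 := by
    refine continuous_iff_continuousAt.2 fun p => ?_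
    have h1 : ContinuousAt (fun p : Plane × Plane => pursuit α 0 p.1 p.2) (r₀, p.2) :=
      continuousAt_pursuit (by have := hden p.2; positivity)
    exact ContinuousAt.comp (f := fun p : ℝ × Plane => (r₀, p.2)) h1
      (by fun_prop)
  have hctrl : ∀ u : Controls t₀, (fun t => pursuit α 0 r₀ (u.1 t)) ∈ Controls t₀ := fun u =>
    ⟨fun t ht => norm_pursuit hα le_rfl (u.2.1 t ht) hr,
      u.2.2.comp_continuous (h := fun p => pursuit α 0 r₀ p.2) hc⟩
  refine ⟨fun u => ⟨_, hctrl u⟩, fun t' _ u u' h => ?_, fun u t ht htf => ?_⟩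
  · filter_upwards [h] with t htu
    simp only [htu]
  -- The `u` terms cancel: `u - α • pursuit α 0 r₀ u = -(travel α 0 r₀ u)⁻¹ • r₀`.
  · have hrel : ∀ s, t₀ ≤ s → traj 1 t₀ xe₀ u.1 s
        - traj α t₀ xp₀ (fun t => pursuit α 0 r₀ (u.1 t)) s
        = (1 - ∫ σ in t₀..s, (travel α 0 r₀ (u.1 σ))⁻¹) • r₀ := fun s hs => by
      rw [traj_sub_traj u.2 (hctrl u) hs, sub_smul, one_smul, ← intervalIntegral.integral_smul_const,
        sub_eq_add_neg r₀, ← intervalIntegral.integral_neg]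
      congr 1
      refine integral_congr_of_Ico hs fun σ hσ => ?_
      have h1 := hden (u.1 σ)
      simp only [pursuit, zero_add]
      rw [smul_smul, mul_inv, mul_inv_cancel_left₀ hα0.ne', smul_add, smul_smul,
        inv_mul_cancel₀ h1.ne', one_smul]
      abel
    set k : ℝ → ℝ := fun s => 1 - ∫ σ in t₀..s, (travel α 0 r₀ (u.1 σ))⁻¹ with hk
    -- Pairing with `r₀` recovers `k` from the continuous trajectories. Since `k t₀ = 1` and `k` has
    -- no zero before capture, it stays positive.
    have hkc : ContinuousOn k (Icc t₀ t) := by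
      have h1 : ContinuousOn (fun s => inner ℝ r₀ (traj 1 t₀ xe₀ u.1 s
          - traj α t₀ xp₀ (fun t => pursuit α 0 r₀ (u.1 t)) s) / ‖r₀‖ ^ 2) (Icc t₀ t) :=
        ((continuousOn_const.inner ((continuousOn_traj 1 xe₀ u.2).sub
          (continuousOn_traj α xp₀ (hctrl u)))).mono fun s hs => hs.1).div_const _
      refine h1.congr fun s hs => ?_
      simp only [hrel s hs.1, inner_smul_right, real_inner_self_eq_norm_sq]
      rw [mul_div_cancel_right₀ _ (by positivity)]
    have hk0 : ∀ s ∈ Icc t₀ t, k s ≠ 0 := fun s hs h0 => by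
      have h1 := lt_norm_of_lt_terminalTime htf hs
      rw [norm_sub_rev] at h1
      dsimp only at h1
      rw [hrel s hs.1, show (1 - ∫ σ in t₀..s, (travel α 0 r₀ (u.1 σ))⁻¹) = 0 from h0] at h1
      simp at h1
    have hkt : 0 < k t := by
      by_contra hneg
      obtain ⟨s, hs, h0⟩ := intermediate_value_Icc' ht hkc ⟨not_lt.1 hneg, by simp [hk]⟩
      exact hk0 s hs h0
    rw [heading_eq_pursuit hα le_rfl (lt_norm_of_lt_terminalTime htf ⟨ht, le_rfl⟩) (u.2.1 t ht)]
    dsimp only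
    rw [hrel t ht]
    exact (pursuit_smul hα (u.2.1 t ht) hkt).symm

end

/-! ### Capture time and confinement to the dominance region -/

section

variable {α l t₀ : ℝ} {xp₀ xe₀ : Plane} {u up : ℝ → Plane}

/-- The distance decreases at rate at least `α - 1`. -/
lemma inner_relative_velocity_le (hα : 1 < α) (hl : 0 ≤ l) {r a : Plane} (hr : l < ‖r‖)
    (ha : ‖a‖ = 1) :
    inner ℝ r (a - α • pursuit α l r a) ≤ -(α - 1) * ‖r‖ := by
  have hD := denom_pos hα hl ha hr
  have hg := denom_smul_pursuit hD
  have hn := norm_add_travel hα hl ha hr.le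
  have hs := travel_pos hα hl ha hr
  set s := travel α l r a
  set g := pursuit α l r a
  have hp : inner ℝ r a ≤ ‖r‖ := inner_le_norm_of_unit ha
  have h1 : (l + α * s) * inner ℝ r g = ‖r‖ ^ 2 + s * inner ℝ r a := by
    rw [← inner_smul_right, hg, inner_add_right, inner_smul_right, real_inner_self_eq_norm_sq]
  have h2 : l + α * s ≤ ‖r‖ + s := by
    rw [← hn]
    refine (norm_add_le _ _).trans ?_
    rw [norm_smul, ha, mul_one, Real.norm_of_nonneg hs.le]
  have h3 : (α - 1) * (l + α * s) ≤ α * ‖r‖ - l := by nlinarith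
  have h4 : ‖r‖ * ((α - 1) * (l + α * s)) ≤ ‖r‖ * (α * ‖r‖ - l) :=
    mul_le_mul_of_nonneg_left h3 (norm_nonneg _)
  have h5 : l * inner ℝ r a ≤ l * ‖r‖ := mul_le_mul_of_nonneg_left hp hl
  rw [inner_sub_right, inner_smul_right]
  refine le_of_mul_le_mul_left ?_ hD
  have h6 : (l + α * s) * (inner ℝ r a - α * inner ℝ r g)
      = l * inner ℝ r a - α * ‖r‖ ^ 2 := by linear_combination -α * h1
  rw [h6]
  linarith

/-- The rate of change of the excess at a point of the dominance region, in terms of the excess. -/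
lemma inner_sub_inner_le (hα : 1 < α) (hl : 0 ≤ l) {r a w : Plane} (hr : l < ‖r‖)
    (ha : ‖a‖ = 1) (hw : ‖w‖ = 1) {ρ : ℝ} (hρ : 0 < ρ) (hG : 0 ≤ ‖r + ρ • w‖ - α * ρ - l) :
    inner ℝ a w - inner ℝ (pursuit α l r a) (‖r + ρ • w‖⁻¹ • (r + ρ • w))
      ≤ 4 / ((α - 1) * ‖r‖) * (‖r + ρ • w‖ - α * ρ - l) := by
  have hα1 : 0 < α - 1 := by linarith
  have hr0 : 0 < ‖r‖ := hl.trans_lt hr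
  have hs := travel_pos hα hl hw hr
  have hD := denom_pos hα hl hw hr
  have hk := denom_smul_pursuit hD
  have hn := norm_add_travel hα hl hw hr.le
  have hg := norm_pursuit hα hl ha hr
  have hi := inner_le_inner_pursuit hα hl hr ha hw
  -- Nonnegative excess puts the point at or before the aim point on its ray; `hmono` then bounds `s
  -- - ρ` by the excess over `α - 1`.
  have hle : ρ ≤ travel α l r w := by
    by_contra h
    have h1 := mul_sub_travel_le hα hl hw hr.le (not_le.1 h).le
    nlinarith [not_le.1 h]
  have hmono := mul_travel_sub_le hα hl hw hr.le hle
  have hray := norm_add_smul_sub_le (r := r) hw (travel α l r w) ρ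
  have hray' := norm_add_smul_sub_le (r := r) hw ρ (travel α l r w)
  rw [abs_sub_comm] at hray'
  set s := travel α l r w
  set g := pursuit α l r a
  set k := pursuit α l r w
  set q := r + ρ • w with hq
  have hq0 : 0 < ‖q‖ := by
    have : 0 < α * ρ := by positivity
    linarith
  set β := ‖q‖⁻¹ • q with hβ
  have hβq : ‖q‖ • β = q := smul_inv_smul₀ hq0.ne' q
  have hβ1 : ‖β‖ = 1 := by
    rw [hβ, norm_smul, norm_inv, norm_norm, inv_mul_cancel₀ hq0.ne']
  rw [hn, abs_of_nonneg (by linarith)] at hray hray'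
  -- Here `β` points at the given point and `k` at the aim point behind it; both terms on the right
  -- have norm at most `s - ρ`.
  have h1 : (l + α * s) • (k - β) = (s - ρ) • w + (‖q‖ - (l + α * s)) • β := by
    rw [smul_sub, hk, sub_smul (‖q‖), hβq, hq]
    module
  have h2 : (l + α * s) * ‖k - β‖ ≤ 2 * (s - ρ) := by
    rw [← Real.norm_of_nonneg hD.le, ← norm_smul, h1]
    refine (norm_add_le _ _).trans ?_
    rw [norm_smul, norm_smul, hw, hβ1, mul_one, mul_one, Real.norm_of_nonneg (by linarith)]
    have : ‖‖q‖ - (l + α * s)‖ ≤ s - ρ := abs_le.2 ⟨by linarith, by linarith⟩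
    linarith
  have h3 : ‖r‖ ≤ 2 * (l + α * s) := by
    have h := norm_sub_le (r + s • w) (s • w)
    rw [add_sub_cancel_right, hn, norm_smul, hw, mul_one, Real.norm_of_nonneg hs.le] at h
    nlinarith
  have h4 : inner ℝ a w - inner ℝ g β ≤ ‖k - β‖ := by
    have h := real_inner_le_norm g (k - β)
    rw [hg, one_mul, inner_sub_right] at h
    linarith
  refine h4.trans ?_
  rw [div_mul_eq_mul_div, le_div_iff₀ (by positivity)]
  have h5 : ‖k - β‖ * ‖r‖ ≤ 4 * (s - ρ) := by
    have := mul_le_mul_of_nonneg_left h3 (norm_nonneg (k - β))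
    linarith
  have h6 := mul_le_mul_of_nonneg_left h5 hα1.le
  linarith

lemma hasDerivWithinAt_norm {f : ℝ → Plane} {f' : Plane} {S : Set ℝ} {t : ℝ}
    (hf : HasDerivWithinAt f f' S t) (h0 : f t ≠ 0) :
    HasDerivWithinAt (fun s => ‖f s‖) (inner ℝ (f t) f' / ‖f t‖) S t := by
  have h1 := hf.norm_sq.sqrt (by have := norm_pos_iff.2 h0; positivity)
  simp only [Real.sqrt_sq (norm_nonneg _)] at h1
  convert h1 using 1
  have := norm_pos_iff.2 h0
  field_simp

/-- Velocities from the right, under the closed-loop control, before capture. -/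
lemma exists_right_velocity (hα : 1 < α) (hl : 0 ≤ l) (hu : u ∈ Controls t₀)
    (hp : up ∈ Controls t₀)
    (hcl : ∀ t : ℝ, t₀ ≤ t → (t : EReal) < terminalTime α l t₀ xp₀ xe₀ up u →
      up t = heading α l (traj α t₀ xp₀ up t) (traj 1 t₀ xe₀ u t) (u t))
    {t : ℝ} (ht : t₀ ≤ t) (htf : (t : EReal) < terminalTime α l t₀ xp₀ xe₀ up u) :
    ∃ a : Plane, ‖a‖ = 1 ∧ HasDerivWithinAt (traj 1 t₀ xe₀ u) a (Ici t) t ∧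
      HasDerivWithinAt (traj α t₀ xp₀ up)
        (α • pursuit α l (traj 1 t₀ xe₀ u t - traj α t₀ xp₀ up t) a) (Ici t) t := by
  obtain ⟨a, ha⟩ := hu.2.2.1 t ht
  have ha1 := norm_eq_one_of_tendsto hu ht ha
  refine ⟨a, ha1, by simpa using hasDerivWithinAt_traj 1 xe₀ hu ht ha,
    hasDerivWithinAt_traj α xp₀ hp ht ?_⟩
  have hsub : Ioi t ⊆ Ici t₀ := fun s hs => ht.trans (le_of_lt hs)
  have hr : Tendsto (fun s => traj 1 t₀ xe₀ u s - traj α t₀ xp₀ up s) (𝓝[>] t)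
      (𝓝 (traj 1 t₀ xe₀ u t - traj α t₀ xp₀ up t)) :=
    (((continuousOn_traj 1 xe₀ hu).sub (continuousOn_traj α xp₀ hp)) t ht).mono_left
      (nhdsWithin_mono t hsub)
  have hn := lt_norm_of_lt_terminalTime htf ⟨ht, le_rfl⟩
  rw [norm_sub_rev] at hn
  have hc : ContinuousAt (fun p : Plane × Plane => pursuit α l p.1 p.2)
      (traj 1 t₀ xe₀ u t - traj α t₀ xp₀ up t, a) :=
    continuousAt_pursuit (denom_pos hα hl ha1 hn).ne'
  refine (hc.tendsto.comp (hr.prodMk_nhds ha)).congr' ?_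
  -- The feedback law persists just after `t`, so the right limit of `up` is the heading for the
  -- right limit `a` of `u`.
  have hev : ∀ᶠ s : ℝ in 𝓝[>] t, (s : EReal) < terminalTime α l t₀ xp₀ xe₀ up u :=
    mem_nhdsWithin_of_mem_nhds
      ((isOpen_Iio.preimage continuous_coe_real_ereal).mem_nhds htf)
  filter_upwards [hev, self_mem_nhdsWithin] with s hs hst
  have hs0 : t₀ ≤ s := hsub hst
  rw [hcl s hs0 hs,
    heading_eq_pursuit hα hl (lt_norm_of_lt_terminalTime hs ⟨hs0, le_rfl⟩) (hu.1 s hs0)]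
  rfl

lemma norm_relative_le (hα : 1 < α) (hl : 0 ≤ l) (hu : u ∈ Controls t₀)
    (hp : up ∈ Controls t₀)
    (hcl : ∀ t : ℝ, t₀ ≤ t → (t : EReal) < terminalTime α l t₀ xp₀ xe₀ up u →
      up t = heading α l (traj α t₀ xp₀ up t) (traj 1 t₀ xe₀ u t) (u t))
    {T : ℝ} (hT : t₀ ≤ T) (hTf : (T : EReal) < terminalTime α l t₀ xp₀ xe₀ up u) :
    ‖traj 1 t₀ xe₀ u T - traj α t₀ xp₀ up T‖ ≤ ‖xp₀ - xe₀‖ - (α - 1) * (T - t₀) := by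
  have hlt : ∀ t ∈ Icc t₀ T, (t : EReal) < terminalTime α l t₀ xp₀ xe₀ up u := fun t ht =>
    (EReal.coe_le_coe_iff.2 ht.2).trans_lt hTf
  choose! a ha hxe hxp using fun t (ht : t ∈ Icc t₀ T) =>
    exists_right_velocity hα hl hu hp hcl ht.1 (hlt t ht)
  have hpos : ∀ t ∈ Icc t₀ T, l < ‖traj 1 t₀ xe₀ u t - traj α t₀ xp₀ up t‖ := fun t ht => by
    rw [norm_sub_rev]; exact lt_norm_of_lt_terminalTime hTf ht
  refine image_le_of_deriv_right_le_deriv_boundary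
    (f := fun t => ‖traj 1 t₀ xe₀ u t - traj α t₀ xp₀ up t‖)
    (B := fun t => ‖xp₀ - xe₀‖ - (α - 1) * (t - t₀)) (B' := fun _ => -(α - 1)) (a := t₀) (b := T)
    (((continuousOn_traj 1 xe₀ hu).sub (continuousOn_traj α xp₀ hp)).norm.mono fun t ht => ht.1)
    (fun t ht => hasDerivWithinAt_norm ((hxe t ⟨ht.1, ht.2.le⟩).sub (hxp t ⟨ht.1, ht.2.le⟩))
      (norm_pos_iff.1 (hl.trans_lt (hpos t ⟨ht.1, ht.2.le⟩))))
    (by simp [traj, norm_sub_rev]) (by fun_prop)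
    (fun t _ => ?_) (fun t ht => ?_) (right_mem_Icc.2 hT)
  · have h1 : HasDerivAt (fun t => ‖xp₀ - xe₀‖ - (α - 1) * (t - t₀)) (-(α - 1)) t := by
      simpa using (((hasDerivAt_id t).sub_const t₀).const_mul (α - 1)).const_sub ‖xp₀ - xe₀‖
    exact h1.hasDerivWithinAt
  · have ht' : t ∈ Icc t₀ T := ⟨ht.1, ht.2.le⟩
    rw [div_le_iff₀ (hl.trans_lt (hpos t ht'))]
    exact inner_relative_velocity_le hα hl (hpos t ht') (ha t ht')

/-- The evader stays in its initial dominance region. -/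
lemma traj_mem_dominanceRegion (hα : 1 < α) (hl : 0 ≤ l) (hu : u ∈ Controls t₀)
    (hp : up ∈ Controls t₀)
    (hcl : ∀ t : ℝ, t₀ ≤ t → (t : EReal) < terminalTime α l t₀ xp₀ xe₀ up u →
      up t = heading α l (traj α t₀ xp₀ up t) (traj 1 t₀ xe₀ u t) (u t))
    {T : ℝ} (hT : t₀ ≤ T) (hTf : (T : EReal) < terminalTime α l t₀ xp₀ xe₀ up u) :
    traj 1 t₀ xe₀ u T ∈ dominanceRegion α l xp₀ xe₀ := by
  have hlt : ∀ t ∈ Icc t₀ T, (t : EReal) < terminalTime α l t₀ xp₀ xe₀ up u := fun t ht =>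
    (EReal.coe_le_coe_iff.2 ht.2).trans_lt hTf
  choose! v hv hxe hxp using fun t (ht : t ∈ Icc t₀ T) =>
    exists_right_velocity hα hl hu hp hcl ht.1 (hlt t ht)
  have hpos : ∀ t ∈ Icc t₀ T, l < ‖traj 1 t₀ xe₀ u t - traj α t₀ xp₀ up t‖ := fun t ht => by
    rw [norm_sub_rev]; exact lt_norm_of_lt_terminalTime hTf ht
  have hce : ContinuousOn (traj 1 t₀ xe₀ u) (Icc t₀ T) :=
    (continuousOn_traj 1 xe₀ hu).mono fun t ht => ht.1
  have hcp : ContinuousOn (traj α t₀ xp₀ up) (Icc t₀ T) :=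
    (continuousOn_traj α xp₀ hp).mono fun t ht => ht.1
  have hxe0 : traj 1 t₀ xe₀ u t₀ = xe₀ := by simp [traj]
  have hxp0 : traj α t₀ xp₀ up t₀ = xp₀ := by simp [traj]
  set xe := traj 1 t₀ xe₀ u
  set xp := traj α t₀ xp₀ up
  set y := xe T with hy
  -- `y` is in the dominance region of the positions at time `t` iff `G t > l`.
  let G : ℝ → ℝ := fun t => ‖y - xp t‖ - α * ‖y - xe t‖
  have hG : ContinuousOn G (Icc t₀ T) :=
    (continuousOn_const.sub hcp).norm.sub
      (continuousOn_const.mul (continuousOn_const.sub hce).norm)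
  -- The least distance `m > 0` makes the Grönwall constant uniform in time.
  obtain ⟨τ, hτ, hmin⟩ := isCompact_Icc.exists_isMinOn ⟨T, right_mem_Icc.2 hT⟩
    (hce.sub hcp).norm
  set m := ‖xe τ - xp τ‖
  have hm : 0 < m := hl.trans_lt (hpos τ hτ)
  have hα1 : 0 < α - 1 := by linarith
  change l < ‖y - xp₀‖ - α * ‖y - xe₀‖
  rw [← hxp0, ← hxe0]
  by_contra hcon
  -- the last time at which the final position is outside the current dominance region
  have hS : IsCompact (Icc t₀ T ∩ G ⁻¹' Iic l) :=
    isCompact_Icc.of_isClosed_subset (hG.preimage_isClosed_of_isClosed isClosed_Icc isClosed_Iic)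
      inter_subset_left
  obtain ⟨a, ⟨haI, haG⟩, hamax⟩ := hS.exists_isGreatest ⟨t₀, left_mem_Icc.2 hT, not_lt.1 hcon⟩
  have hGT : l < G T := by simpa [G, hy] using hpos T (right_mem_Icc.2 hT)
  have haT : a < T := lt_of_le_of_ne haI.2 fun h => by
    rw [h] at haG
    exact absurd haG (not_le.2 hGT)
  have hafter : ∀ t ∈ Ioc a T, l < G t := fun t ht => by
    by_contra h
    exact absurd (hamax ⟨⟨haI.1.trans ht.1.le, ht.2⟩, not_lt.1 h⟩) (not_le.2 ht.1)
  have hsub : Icc a T ⊆ Icc t₀ T := Icc_subset_Icc_left haI.1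
  have hfrom : ∀ t ∈ Icc a T, l ≤ G t := by
    have h1 : IsClosed (Icc a T ∩ G ⁻¹' Ici l) :=
      (hG.mono hsub).preimage_isClosed_of_isClosed isClosed_Icc isClosed_Ici
    have h2 : closure (Ioc a T) ⊆ Icc a T ∩ G ⁻¹' Ici l :=
      closure_minimal (fun t ht => ⟨⟨ht.1.le, ht.2⟩, (hafter t ht).le⟩) h1
    rw [closure_Ioc haT.ne] at h2
    exact fun t ht => (h2 ht).2
  have hne : xe a ≠ y := fun h => by
    have h1 := hpos a haI
    have h2 : G a ≤ l := haG
    simp only [G, h, sub_self, norm_zero, mul_zero, sub_zero] at h2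
    rw [h] at h1
    linarith
  -- `‖y - xe t‖` must be differentiable, so `xe` has to avoid `y`; a short interval after `a`
  -- suffices for the contradiction at `b`.
  obtain ⟨b, hb, hbne⟩ : ∃ b ∈ Ioc a T, ∀ t ∈ Icc a b, xe t ≠ y := by
    have h1 : ∀ᶠ t in 𝓝[≥] a, xe t ≠ y := by
      have h2 : ContinuousWithinAt xe (Icc a T) a := (hce a haI).mono hsub
      have h3 := h2.eventually_ne hne
      rwa [nhdsWithin_Icc_eq_nhdsGE haT] at h3
    obtain ⟨c, hc, hcs⟩ := mem_nhdsGE_iff_exists_Icc_subset.1 h1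
    refine ⟨min c T, ⟨lt_min hc haT, min_le_right _ _⟩, fun t ht => hcs ⟨ht.1, ht.2.trans ?_⟩⟩
    exact min_le_left _ _
  have hbT : Icc a b ⊆ Icc a T := Icc_subset_Icc_right hb.2
  have hgron := le_gronwallBound_of_liminf_deriv_right_le (f := fun t => G t - l)
    (f' := fun t => inner ℝ (y - xp t) (-(α • pursuit α l (xe t - xp t) (v t))) / ‖y - xp t‖
      - α * (inner ℝ (y - xe t) (-(v t)) / ‖y - xe t‖))
    (δ := 0) (K := α * (4 / ((α - 1) * m))) (ε := 0) (a := a) (b := b)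
    ((hG.mono (hbT.trans hsub)).sub continuousOn_const) ?_ (sub_nonpos.2 haG) ?_ b
    (right_mem_Icc.2 hb.1.le)
  · rw [gronwallBound_ε0_δ0] at hgron
    have := hafter b hb
    linarith
  · intro t ht
    have htI : t ∈ Icc a b := ⟨ht.1, ht.2.le⟩
    have ht0 := hsub (hbT htI)
    have hye : y - xe t ≠ 0 := sub_ne_zero.2 (hbne t htI).symm
    have hyp : y - xp t ≠ 0 := by
      have h1 := hfrom t (hbT htI)
      have h2 : 0 < α * ‖y - xe t‖ := mul_pos (by linarith) (norm_pos_iff.2 hye)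
      refine norm_pos_iff.1 ?_
      simp only [G] at h1
      linarith
    have hd : HasDerivWithinAt (fun t => G t - l)
        (inner ℝ (y - xp t) (-(α • pursuit α l (xe t - xp t) (v t))) / ‖y - xp t‖
          - α * (inner ℝ (y - xe t) (-(v t)) / ‖y - xe t‖)) (Ici t) t :=
      ((hasDerivWithinAt_norm ((hxp t ht0).const_sub y) hyp).sub
        ((hasDerivWithinAt_norm ((hxe t ht0).const_sub y) hye).const_mul α)).sub_const l
    exact fun q hq => by
      simpa [slope_def_field, div_eq_inv_mul] using hd.liminf_right_slope_le hq
  · intro t ht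
    have htI : t ∈ Icc a b := ⟨ht.1, ht.2.le⟩
    have ht0 := hsub (hbT htI)
    have hρ : 0 < ‖y - xe t‖ := norm_pos_iff.2 (sub_ne_zero.2 (hbne t htI).symm)
    have hGt : 0 ≤ G t - l := sub_nonneg.2 (hfrom t (hbT htI))
    set w := ‖y - xe t‖⁻¹ • (y - xe t) with hw
    have hw1 : ‖w‖ = 1 := by rw [hw, norm_smul, norm_inv, norm_norm, inv_mul_cancel₀ hρ.ne']
    have hyw : ‖y - xe t‖ • w = y - xe t := smul_inv_smul₀ hρ.ne' _
    have hq : xe t - xp t + ‖y - xe t‖ • w = y - xp t := by rw [hyw]; abel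
    have h1 := inner_sub_inner_le (ρ := ‖y - xe t‖) hα hl (hpos t ht0) (hv t ht0) hw1 hρ
      (by rw [hq]; simp only [G] at hGt; linarith)
    rw [hq] at h1
    have h2 : 4 / ((α - 1) * ‖xe t - xp t‖) ≤ 4 / ((α - 1) * m) := by
      gcongr
      exact hmin ht0
    have h3 : inner ℝ (v t) w - inner ℝ (pursuit α l (xe t - xp t) (v t))
        (‖y - xp t‖⁻¹ • (y - xp t)) ≤ 4 / ((α - 1) * m) * (G t - l) :=
      h1.trans ((mul_le_mul_of_nonneg_right h2 hGt).trans' (le_of_eq (by simp only [G])))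
    have h4 := mul_le_mul_of_nonneg_left h3 (by linarith : 0 ≤ α)
    rw [hw, inner_smul_right, inner_smul_right, real_inner_comm, real_inner_comm (y - xp t)] at h4
    rw [inner_neg_right, inner_neg_right, inner_smul_right, add_zero]
    refine le_trans (le_of_eq ?_) (h4.trans (le_of_eq (by ring)))
    ring

end

end PursuitEvasion

end

theorem mainTheorem3 (α l t₀ : ℝ) (hα : 1 < α) (hl : 0 ≤ l)
    (xp₀ xe₀ : PursuitEvasion.Plane) (h₀ : l < ‖xp₀ - xe₀‖) :
    -- the aim point is well defined at every state before capture
    (∀ xp xe u : PursuitEvasion.Plane, l < ‖xp - xe‖ → ‖u‖ = 1 →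
      ∃! x, PursuitEvasion.IsAimPoint α l xp xe u x) ∧
    -- the strategy exists
    (∃ δ, PursuitEvasion.IsDeltaStar α l t₀ xp₀ xe₀ δ) ∧
    -- and, however it is continued after capture, it has the properties (a) and (b)
    ∀ δ, PursuitEvasion.IsDeltaStar α l t₀ xp₀ xe₀ δ →
      ((∃ c : ℝ, 0 < c ∧ ∀ u : PursuitEvasion.Controls t₀,
          PursuitEvasion.terminalTime α l t₀ xp₀ xe₀ (δ u).1 u.1 < (c : EReal)) ∧
        ∀ u : PursuitEvasion.Controls t₀,
          PursuitEvasion.terminalTime α l t₀ xp₀ xe₀ (δ u).1 u.1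
            ≤ ((t₀ + (‖xp₀ - xe₀‖ - l) / (α - 1) : ℝ) : EReal)) ∧
      ∀ u : PursuitEvasion.Controls t₀, ∀ t : ℝ, t₀ ≤ t →
        (t : EReal) < PursuitEvasion.terminalTime α l t₀ xp₀ xe₀ (δ u).1 u.1 →
        PursuitEvasion.traj 1 t₀ xe₀ u.1 t
          ∈ PursuitEvasion.dominanceRegion α l xp₀ xe₀ := by
  refine ⟨fun xp xe u h hu => PursuitEvasion.existsUnique_isAimPoint hα hl h hu, ?_,
    fun δ hδ => ?_⟩
  · rcases hl.eq_or_lt with rfl | hl'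
    · exact PursuitEvasion.exists_isDeltaStar_zero hα h₀
    · exact PursuitEvasion.exists_isDeltaStar_of_pos hα hl' xp₀ xe₀ t₀
  · have hα1 : 0 < α - 1 := by linarith
    have hbound : ∀ u : PursuitEvasion.Controls t₀,
        PursuitEvasion.terminalTime α l t₀ xp₀ xe₀ (δ u).1 u.1
          ≤ ((t₀ + (‖xp₀ - xe₀‖ - l) / (α - 1) : ℝ) : EReal) := fun u => by
      by_contra hlt
      have ht : t₀ ≤ t₀ + (‖xp₀ - xe₀‖ - l) / (α - 1) :=
        le_add_of_nonneg_right (div_nonneg (by linarith) hα1.le)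
      -- At this time the linear bound on the distance has come down to exactly `l`.
      have h1 := PursuitEvasion.norm_relative_le hα hl u.2 (δ u).2 (hδ.2 u) ht (not_le.1 hlt)
      have h2 := PursuitEvasion.lt_norm_of_lt_terminalTime (not_le.1 hlt) ⟨ht, le_rfl⟩
      rw [norm_sub_rev] at h2
      rw [add_sub_cancel_left, mul_div_cancel₀ _ hα1.ne'] at h1
      linarith
    -- `t₀` may be negative: the absolute value gives `0 < c`, and the `+ 1` a strict bound.
    refine ⟨⟨⟨|t₀ + (‖xp₀ - xe₀‖ - l) / (α - 1)| + 1, by positivity, fun u =>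
      (hbound u).trans_lt (EReal.coe_lt_coe_iff.2 ?_)⟩, hbound⟩, fun u t ht htf =>
      PursuitEvasion.traj_mem_dominanceRegion hα hl u.2 (δ u).2 (hδ.2 u) ht htf⟩
    exact (le_abs_self _).trans_lt (lt_add_one _)
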